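/- Let $p,q\ge 1$ be integers. Let $(\bar M,g)$ be a smooth Riemannian manifold of dimension $n+r$ with Levi-Civita connection $\bar\nabla$, and let $J$ be a smooth $(1,1)$-tensor field on $\bar M$ such that $J^2=pJ+qI$, $g(JX,Y)=g(X,JY)$ for all vector fields $X,Y$, and $\bar\nabla J=0$ (that is, $(\bar M,J,g)$ is a locally metallic Riemannian manifold). Let $M$ be an $n$-dimensional Riemannian manifold isometrically immersed in $\bar M$, with Levi-Civita connection $\nabla$, and identify $T_xM$ with its image in $T_x\bar M=T_xM\oplus T_xM^\perp$; write $W=W^T+W^\perp$ for the corresponding decomposition. Suppose that $M$ is anti-invariant: $J(T_xM)\subset T_xM^\perp$ for every $x\in M$. Let $N_1,\dots,N_r$ be a smooth orthonormal frame of the normal bundle $TM^\perp$ over an open set $U\subset M$. For vector fields $X,Y$ on $M$ and a normal vector field $V$ put $$h(X,Y)=(\bar\nabla_XY)^\perp,\quad h_\alpha(X,Y)=g(h(X,Y),N_\alpha),\quad g(A_{N_\alpha}X,Y)=h_\alpha(X,Y),$$ $$\nabla^\perp_XV=(\bar\nabla_XV)^\perp,\quad tV=(JV)^T,\quad nV=(JV)^\perp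 .$$ Then, for all $X,Y\in\Gamma(TM)$, one has on $U$ $$\sum_{\alpha=1}^r h_\alpha(X,Y)\,tN_\alpha=-\sum_{\alpha=1}^r g(JY,N_\alpha)\,A_{N_\alpha}X,$$ $$\sum_{\alpha=1}^r h_\alpha(X,Y)\,nN_\alpha=\sum_{\alpha=1}^r g(JY,N_\alpha)\,\nabla^\perp_XN_\alpha+\sum_{\alpha=1}^r X\big(g(JY,N_\alpha)\big)N_\alpha-J(\nabla_XY).$$ -/

import Mathlib

open Bundle Set
open scoped Manifold ContDiff Topology

noncomputable section

namespace MetallicGeometry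

/-! ### Metallic Riemannian manifolds -/

section Ambient

variable {E : Type*} [NormedAddCommGroup E] [NormedSpace ℝ E] [FiniteDimensional ℝ E]
  {H : Type*} [TopologicalSpace H] {I : ModelWithCorners ℝ E H}
  {M : Type*} [TopologicalSpace M] [ChartedSpace H M] [IsManifold I ∞ M]

/-- Tangent spaces of a finite dimensional manifold are finite dimensional. -/
instance tangentSpaceFiniteDimensional (x : M) : FiniteDimensional ℝ (TangentSpace I x) :=
  inferInstanceAs (FiniteDimensional ℝ E)

/-- The `(1,1)`-tensor field `J` is smooth, as a section of the bundle `End(TM)`. -/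
def IsSmoothTensorField
    (J : Π x : M, TangentSpace I x →L[ℝ] TangentSpace I x) : Prop :=
  ContMDiff I (I.prod 𝓘(ℝ, E →L[ℝ] E)) ∞
    (fun x => TotalSpace.mk' (E →L[ℝ] E)
      (E := fun x : M => TangentSpace I x →L[ℝ] TangentSpace I x) x (J x))

/-- `J` is parallel for the connection `cov`: `(∇_u J) Y = ∇_u (J Y) - J (∇_u Y) = 0` for every
point `x`, every tangent vector `u` at `x` and every vector field `Y` that is differentiable
at `x`. -/
def IsParallelTensorField (cov : CovariantDerivative I E (TangentSpace I : M → Type _))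
    (J : Π x : M, TangentSpace I x →L[ℝ] TangentSpace I x) : Prop :=
  ∀ (x : M) (u : TangentSpace I x) (Y : Π y : M, TangentSpace I y),
    MDifferentiableAt I I.tangent (fun y => (⟨y, Y y⟩ : TangentBundle I M)) x →
      cov (fun y => J y (Y y)) x u - J x (cov Y x u) = 0

variable [RiemannianBundle (fun x : M => TangentSpace I x)]

/-- `J` is a `(p, q)`-metallic structure, and the Riemannian metric of `M` is compatible with
it. -/
structure IsMetallicRiemannian (p q : ℕ)
    (J : Π x : M, TangentSpace I x →L[ℝ] TangentSpace I x) : Prop where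
  p_pos : 0 < p
  q_pos : 0 < q
  smooth : IsSmoothTensorField J
  sq_eq : ∀ (x : M) (v : TangentSpace I x), J x (J x v) = (p : ℝ) • J x v + (q : ℝ) • v
  compatible : ∀ (x : M) (v w : TangentSpace I x), inner ℝ (J x v) w = inner ℝ v (J x w)

/-- `cov` is the Levi-Civita connection of the Riemannian metric of `M`: it is compatible with the
metric, `u (g(Y, Z)) = g(∇_u Y, Z) + g(Y, ∇_u Z)`, and torsion free. -/
structure IsLeviCivita (cov : CovariantDerivative I E (TangentSpace I : M → Type _)) : Prop where
  metric : ∀ (x : M) (u : TangentSpace I x) (Y Z : Π y : M, TangentSpace I y),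
    MDifferentiableAt I I.tangent (fun y => (⟨y, Y y⟩ : TangentBundle I M)) x →
    MDifferentiableAt I I.tangent (fun y => (⟨y, Z y⟩ : TangentBundle I M)) x →
      mvfderiv I (fun y => inner ℝ (Y y) (Z y)) x u
        = inner ℝ (cov Y x u) (Z x) + inner ℝ (Y x) (cov Z x u)
  torsion : cov.torsion = 0

/-- `(M, J, g)`, with Levi-Civita connection `cov`, is a locally metallic Riemannian manifold. -/
structure IsLocallyMetallicRiemannian (p q : ℕ)
    (J : Π x : M, TangentSpace I x →L[ℝ] TangentSpace I x)
    (cov : CovariantDerivative I E (TangentSpace I : M → Type _)) : Prop where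
  metallic : IsMetallicRiemannian p q J
  leviCivita : IsLeviCivita cov
  parallel : IsParallelTensorField cov J

end Ambient

/-! ### Isometric immersions -/

section Submanifold

variable {E : Type*} [NormedAddCommGroup E] [NormedSpace ℝ E] [FiniteDimensional ℝ E]
  {H : Type*} [TopologicalSpace H] (I : ModelWithCorners ℝ E H)
  {M : Type*} [TopologicalSpace M] [ChartedSpace H M] [IsManifold I ∞ M]
  {E' : Type*} [NormedAddCommGroup E'] [NormedSpace ℝ E'] [FiniteDimensional ℝ E']
  {H' : Type*} [TopologicalSpace H'] (I' : ModelWithCorners ℝ E' H')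
  {M' : Type*} [TopologicalSpace M'] [ChartedSpace H' M'] [IsManifold I' ∞ M']

/-- The vector field `f_* Y` along `f`, for a vector field `Y` on `M`. -/
def pushforward (f : M → M')
    (Y : Π x : M, TangentSpace I x) (x : M) : TangentSpace I' (f x) :=
  mfderiv I I' f x (Y x)

/-- The connection along `f`, i.e. the pullback connection `f^* cov` on `f^* TM'`, applied to the
vector field `V` along `f` in the direction `u ∈ T_x M`.
In terms of the frame `(e_i)` given by the trivialization of `TM'` around `f x`, in which
`V = ∑ v_i (e_i ∘ f)`, it is `∑ dv_i(u) e_i + ∑ v_i(x) ∇_{df(u)} e_i`; the field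
`∑ v_i(x) e_i` is `FiberBundle.extend E' (V x)`. -/
def covAlong (cov : CovariantDerivative I' E' (TangentSpace I' : M' → Type _)) (f : M → M')
    (V : Π x : M, TangentSpace I' (f x)) (x : M) (u : TangentSpace I x) :
    TangentSpace I' (f x) :=
  (trivializationAt E' (TangentSpace I' : M' → Type _) (f x)).symm (f x)
      (mvfderiv I (fun y : M =>
        ((trivializationAt E' (TangentSpace I' : M' → Type _) (f x)) ⟨f y, V y⟩).2) x u)
    + cov (FiberBundle.extend E' (V x)) (f x) (mfderiv I I' f x u)

/-- The image `df(T_x M)` of the tangent space of `M` in `T_{f x} M'`. -/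
def tangentImage (f : M → M') (x : M) : Submodule ℝ (TangentSpace I' (f x)) :=
  LinearMap.range (mfderiv I I' f x).toLinearMap

variable [RiemannianBundle (fun x : M' => TangentSpace I' x)]

/-- The tangential part `w^T` of `w ∈ T_{f x} M'`, as a vector in `df(T_x M)`. -/
def tangentialPart (f : M → M') (x : M) (w : TangentSpace I' (f x)) : TangentSpace I' (f x) :=
  (tangentImage I I' f x).starProjection w

/-- The normal part `w^⊥` of `w ∈ T_{f x} M'`. -/
def normalPart (f : M → M') (x : M) (w : TangentSpace I' (f x)) : TangentSpace I' (f x) :=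
  (tangentImage I I' f x)ᗮ.starProjection w

/-- `M` is anti-invariant: `J(T_x M) ⊆ (T_x M)^⊥` for every `x`. -/
def IsAntiInvariant (f : M → M')
    (J : Π y : M', TangentSpace I' y →L[ℝ] TangentSpace I' y) : Prop :=
  ∀ x : M, (tangentImage I I' f x).map (J (f x)).toLinearMap ≤ (tangentImage I I' f x)ᗮ

/-- The second fundamental form `h(u, Y) = (∇_u f_* Y)^⊥` at `x`, where `u ∈ T_x M`, `Y` is a vector
field on `M` and the derivative is taken with the ambient connection `cov`. -/
def secondFundamentalForm (cov : CovariantDerivative I' E' (TangentSpace I' : M' → Type _))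
    (f : M → M') (x : M) (u : TangentSpace I x) (Y : Π y : M, TangentSpace I y) : TangentSpace I' (f x) :=
  normalPart I I' f x (covAlong I I' cov f (pushforward I I' f Y) x u)

/-- The normal connection `∇^⊥_u ξ = (∇_u ξ)^⊥`, for a normal vector field `ξ` along `f`. -/
def normalConnection (cov : CovariantDerivative I' E' (TangentSpace I' : M' → Type _)) (f : M → M')
    (ξ : Π x : M, TangentSpace I' (f x)) (x : M) (u : TangentSpace I x) : TangentSpace I' (f x) :=
  normalPart I I' f x (covAlong I I' cov f ξ x u)

/-- `N_1, …, N_r` is a smooth orthonormal frame of the normal bundle of `f` over `U`. -/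
structure IsNormalFrameOn (f : M → M')
    {r : ℕ} (N : Fin r → Π x : M, TangentSpace I' (f x)) (U : Set M) : Prop where
  smooth : ∀ α, ContMDiffOn I I'.tangent ∞ (fun x => (⟨f x, N α x⟩ : TangentBundle I' M')) U
  orthonormal : ∀ x ∈ U, Orthonormal ℝ (fun α => N α x)
  span : ∀ x ∈ U, Submodule.span ℝ (Set.range fun α => N α x) = (tangentImage I I' f x)ᗮ

variable [RiemannianBundle (fun x : M => TangentSpace I x)]

/-- `f` is a smooth isometric immersion (injectivity of `df` follows from the metric condition). -/
structure IsIsometricImmersion (f : M → M') : Prop where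
  smooth : ContMDiff I I' ∞ f
  isometric : ∀ (x : M) (u v : TangentSpace I x),
    inner ℝ (mfderiv I I' f x u) (mfderiv I I' f x v) = inner ℝ u v

/-- The shape operator `A_ξ u` at `x` in the direction `ξ`: the vector `a ∈ T_x M` determined by
`g(a, Y x) = g(h(u, Y), ξ)` for all vector fields `Y`. -/
def shapeOperator (cov : CovariantDerivative I' E' (TangentSpace I' : M' → Type _)) (f : M → M')
    (x : M) (ξ : TangentSpace I' (f x)) (u : TangentSpace I x) : TangentSpace I x :=
  Classical.epsilon fun a : TangentSpace I x =>
    ∀ Y : Π y : M, TangentSpace I y,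
      MDifferentiableAt I I.tangent (fun y => (⟨y, Y y⟩ : TangentBundle I M)) x →
        inner ℝ a (Y x) = inner ℝ (secondFundamentalForm I I' cov f x u Y) ξ

end Submanifold

end MetallicGeometry

end

set_option linter.unusedSectionVars false

noncomputable section

namespace MetallicGeometry

section FieldsAlong

variable {E : Type*} [NormedAddCommGroup E] [NormedSpace ℝ E] [FiniteDimensional ℝ E]
  {H : Type*} [TopologicalSpace H] {I : ModelWithCorners ℝ E H}
  {M : Type*} [TopologicalSpace M] [ChartedSpace H M] [IsManifold I ∞ M]
  {E' : Type*} [NormedAddCommGroup E'] [NormedSpace ℝ E'] [FiniteDimensional ℝ E']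
  {H' : Type*} [TopologicalSpace H'] {I' : ModelWithCorners ℝ E' H'}
  {M' : Type*} [TopologicalSpace M'] [ChartedSpace H' M'] [IsManifold I' ∞ M']

variable (I I') in
/-- The vector field `V` along `f` is differentiable at `x`. -/
abbrev MDifferentiableAlongAt (f : M → M') (V : Π x : M, TangentSpace I' (f x)) (x : M) : Prop :=
  MDifferentiableAt I I'.tangent (fun y => (⟨f y, V y⟩ : TangentBundle I' M')) x

variable (I') in
/-- The coordinates, in the trivialization of `TM'` around `f x`, of a vector field along `f`. -/
def coordAlong (f : M → M') (x : M) (V : Π x : M, TangentSpace I' (f x)) (y : M) : E' :=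
  ((trivializationAt E' (TangentSpace I' : M' → Type _) (f x)) ⟨f y, V y⟩).2

variable {f : M → M'} {x : M} {V W : Π x : M, TangentSpace I' (f x)}

lemma mdifferentiableAlongAt_iff (hf : MDifferentiableAt I I' f x) :
    MDifferentiableAlongAt I I' f V x ↔
      MDifferentiableAt I 𝓘(ℝ, E') (coordAlong I' f x V) x := by
  rw [MDifferentiableAlongAt, mdifferentiableAt_totalSpace]
  exact and_iff_right hf

lemma coordAlong_add {y : M}
    (hy : f y ∈ (trivializationAt E' (TangentSpace I' : M' → Type _) (f x)).baseSet) :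
    coordAlong I' f x (V + W) y = coordAlong I' f x V y + coordAlong I' f x W y :=
  ((trivializationAt E' (TangentSpace I' : M' → Type _) (f x)).linear ℝ hy).map_add _ _

lemma coordAlong_smul {y : M} {g : M → ℝ}
    (hy : f y ∈ (trivializationAt E' (TangentSpace I' : M' → Type _) (f x)).baseSet) :
    coordAlong I' f x (fun z => g z • V z) y = g y • coordAlong I' f x V y :=
  ((trivializationAt E' (TangentSpace I' : M' → Type _) (f x)).linear ℝ hy).map_smul _ _

lemma eventually_mem_baseSet (hf : ContinuousAt f x) :
    ∀ᶠ y in 𝓝 x, f y ∈ (trivializationAt E' (TangentSpace I' : M' → Type _) (f x)).baseSet :=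
  hf ((trivializationAt E' (TangentSpace I' : M' → Type _) (f x)).open_baseSet.mem_nhds
    (FiberBundle.mem_baseSet_trivializationAt' (f x)))

lemma coordAlong_add_eventuallyEq (hf : ContinuousAt f x) :
    coordAlong I' f x (V + W) =ᶠ[𝓝 x] coordAlong I' f x V + coordAlong I' f x W := by
  filter_upwards [eventually_mem_baseSet (I' := I') hf] with y hy using coordAlong_add hy

lemma coordAlong_smul_eventuallyEq {g : M → ℝ} (hf : ContinuousAt f x) :
    coordAlong I' f x (fun z => g z • V z) =ᶠ[𝓝 x] g • coordAlong I' f x V := by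
  filter_upwards [eventually_mem_baseSet (I' := I') hf] with y hy using coordAlong_smul hy

lemma MDifferentiableAlongAt.add (hf : MDifferentiableAt I I' f x)
    (hV : MDifferentiableAlongAt I I' f V x) (hW : MDifferentiableAlongAt I I' f W x) :
    MDifferentiableAlongAt I I' f (V + W) x := by
  rw [mdifferentiableAlongAt_iff hf] at hV hW ⊢
  exact (hV.add hW).congr_of_eventuallyEq (coordAlong_add_eventuallyEq hf.continuousAt)

lemma MDifferentiableAlongAt.smul {g : M → ℝ} (hf : MDifferentiableAt I I' f x)
    (hg : MDifferentiableAt I 𝓘(ℝ, ℝ) g x) (hV : MDifferentiableAlongAt I I' f V x) :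
    MDifferentiableAlongAt I I' f (fun y => g y • V y) x := by
  rw [mdifferentiableAlongAt_iff hf] at hV ⊢
  exact (hg.smul hV).congr_of_eventuallyEq (coordAlong_smul_eventuallyEq hf.continuousAt)

lemma MDifferentiableAlongAt.comp {Z : Π y : M', TangentSpace I' y}
    (hf : MDifferentiableAt I I' f x)
    (hZ : MDifferentiableAt I' I'.tangent (fun y => (⟨y, Z y⟩ : TangentBundle I' M')) (f x)) :
    MDifferentiableAlongAt I I' f (fun y => Z (f y)) x :=
  MDifferentiableAt.comp x hZ hf

/-- The extension of a tangent vector to a vector field is additive near the base point. -/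
lemma extend_add_eventuallyEq {y : M'} (v w : TangentSpace I' y) :
    ∀ᶠ z in 𝓝 y, FiberBundle.extend E' (v + w) z
      = FiberBundle.extend E' v z + FiberBundle.extend E' w z := by
  set e := trivializationAt E' (TangentSpace I' : M' → Type _) y with he
  have hy : y ∈ e.baseSet := FiberBundle.mem_baseSet_trivializationAt' y
  filter_upwards [e.open_baseSet.mem_nhds hy] with z hz
  have h := (e.linear ℝ hy).map_add v w
  simp only [FiberBundle.extend, ← he]
  rw [h]
  simp only [← e.coe_symmₗ (R := ℝ) hz, map_add]

/-- The extension of a tangent vector to a vector field is homogeneous near the base point. -/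
lemma extend_smul_eventuallyEq {y : M'} (c : ℝ) (v : TangentSpace I' y) :
    ∀ᶠ z in 𝓝 y, FiberBundle.extend E' (c • v) z = c • FiberBundle.extend E' v z := by
  set e := trivializationAt E' (TangentSpace I' : M' → Type _) y with he
  have hy : y ∈ e.baseSet := FiberBundle.mem_baseSet_trivializationAt' y
  filter_upwards [e.open_baseSet.mem_nhds hy] with z hz
  have h := (e.linear ℝ hy).map_smul c v
  simp only [FiberBundle.extend, ← he]
  rw [h]
  simp only [← e.coe_symmₗ (R := ℝ) hz, map_smul]

lemma mdifferentiableAt_extend_tangent {y : M'} (v : TangentSpace I' y) :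
    MDifferentiableAt I' I'.tangent
      (fun z => (⟨z, FiberBundle.extend E' v z⟩ : TangentBundle I' M')) y :=
  haveI : IsManifold I' 1 M' := IsManifold.of_le (n := ∞) (by simp)
  FiberBundle.mdifferentiableAt_extend I' E' v

/-- A property of vector fields along `f` that is compatible with germs, sums and products with
functions holds for all fields once it holds for restrictions of vector fields of `M'`. -/
lemma along_induction (hf : MDifferentiableAt I I' f x)
    (P : (Π x : M, TangentSpace I' (f x)) → Prop)
    (hgerm : ∀ V W, MDifferentiableAlongAt I I' f V x → MDifferentiableAlongAt I I' f W x →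
      (∀ᶠ y in 𝓝 x, V y = W y) → P V → P W)
    (hadd : ∀ V W, MDifferentiableAlongAt I I' f V x → MDifferentiableAlongAt I I' f W x →
      P V → P W → P (V + W))
    (hsmul : ∀ (g : M → ℝ) V, MDifferentiableAt I 𝓘(ℝ, ℝ) g x → MDifferentiableAlongAt I I' f V x →
      P V → P (fun y => g y • V y))
    (hcomp : ∀ Z : Π y : M', TangentSpace I' y,
      MDifferentiableAt I' I'.tangent (fun y => (⟨y, Z y⟩ : TangentBundle I' M')) (f x) →
      P (fun y => Z (f y)))
    (hV : MDifferentiableAlongAt I I' f V x) : P V := by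
  classical
  set e := trivializationAt E' (TangentSpace I' : M' → Type _) (f x) with he
  have hx : f x ∈ e.baseSet := FiberBundle.mem_baseSet_trivializationAt' (f x)
  let b := Module.finBasis ℝ E'
  let Z (i : Fin (Module.finrank ℝ E')) (y : M') : TangentSpace I' y :=
    FiberBundle.extend E' (e.symm (f x) (b i)) y
  have hZ i : MDifferentiableAt I' I'.tangent (fun y => (⟨y, Z i y⟩ : TangentBundle I' M')) (f x) :=
    mdifferentiableAt_extend_tangent _
  let c (i : Fin (Module.finrank ℝ E')) (y : M) : ℝ := b.coord i (coordAlong I' f x V y)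
  have hc i : MDifferentiableAt I 𝓘(ℝ, ℝ) (c i) x :=
    ((b.coord i).toContinuousLinearMap.differentiableAt.mdifferentiableAt.comp x
      ((mdifferentiableAlongAt_iff hf).1 hV))
  have hsum (s : Finset (Fin (Module.finrank ℝ E'))) :
      MDifferentiableAlongAt I I' f (fun y => ∑ i ∈ s, c i y • Z i (f y)) x ∧
        P (fun y => ∑ i ∈ s, c i y • Z i (f y)) := by
    induction s using Finset.induction_on with
    | empty =>
      have h0 := hcomp _ (mdifferentiableAt_zeroSection ℝ (TangentSpace I' : M' → Type _) (x := f x) (IB := I'))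
      simp only [Finset.sum_empty]
      exact ⟨MDifferentiableAlongAt.comp hf (mdifferentiableAt_zeroSection ℝ (TangentSpace I' : M' → Type _)), h0⟩
    | insert i s hi ih =>
      simp only [Finset.sum_insert hi]
      have h1 := (MDifferentiableAlongAt.comp hf (hZ i))
      have h2 := h1.smul hf (hc i)
      exact ⟨h2.add hf ih.1, hadd _ _ h2 ih.1 (hsmul _ _ (hc i) h1 (hcomp _ (hZ i))) ih.2⟩
  refine hgerm _ _ (hsum Finset.univ).1 hV ?_ (hsum Finset.univ).2
  filter_upwards [eventually_mem_baseSet (I' := I') hf.continuousAt] with y hy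
  have hZy i : Z i (f y) = e.symmₗ ℝ (f y) (b i) := by
    simp only [Z, FiberBundle.extend, ← he]
    rw [e.apply_mk_symm hx, e.coe_symmₗ hy]
  simp only [hZy, ← map_smul, ← map_sum, c]
  have := b.sum_repr (coordAlong I' f x V y)
  simp only [Module.Basis.coord_apply]
  rw [this]
  rw [e.coe_symmₗ hy]
  exact e.symm_apply_apply_mk hy (V y)

end FieldsAlong

section ConnectionAlong

variable {E : Type*} [NormedAddCommGroup E] [NormedSpace ℝ E] [FiniteDimensional ℝ E]
  {H : Type*} [TopologicalSpace H] {I : ModelWithCorners ℝ E H}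
  {M : Type*} [TopologicalSpace M] [ChartedSpace H M] [IsManifold I ∞ M]
  {E' : Type*} [NormedAddCommGroup E'] [NormedSpace ℝ E'] [FiniteDimensional ℝ E']
  {H' : Type*} [TopologicalSpace H'] {I' : ModelWithCorners ℝ E' H'}
  {M' : Type*} [TopologicalSpace M'] [ChartedSpace H' M'] [IsManifold I' ∞ M']
  (cov : CovariantDerivative I' E' (TangentSpace I' : M' → Type _))

lemma cov_extend_add {y : M'} (v w : TangentSpace I' y) :
    cov (FiberBundle.extend E' (v + w)) y
      = cov (FiberBundle.extend E' v) y + cov (FiberBundle.extend E' w) y := by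
  have hc := cov.isCovariantDerivativeOn (s := univ)
  have hv := mdifferentiableAt_extend_tangent v
  have hw := mdifferentiableAt_extend_tangent w
  rw [← hc.add hv hw]
  exact hc.congr_of_eventuallyEq (mdifferentiableAt_extend_tangent _)
    (mdifferentiableAt_add_section hv hw) Filter.univ_mem (extend_add_eventuallyEq v w)

lemma cov_extend_smul {y : M'} (c : ℝ) (v : TangentSpace I' y) :
    cov (FiberBundle.extend E' (c • v)) y = c • cov (FiberBundle.extend E' v) y := by
  have hc := cov.isCovariantDerivativeOn (s := univ)
  have hv := mdifferentiableAt_extend_tangent v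
  rw [← hc.smul_const c hv]
  exact hc.congr_of_eventuallyEq (mdifferentiableAt_extend_tangent _)
    (mdifferentiableAt_const.smul_section hv) Filter.univ_mem (extend_smul_eventuallyEq c v)

variable {f : M → M'} {x : M} {V W : Π x : M, TangentSpace I' (f x)}

lemma covAlong_eq (u : TangentSpace I x) :
    covAlong I I' cov f V x u =
      (trivializationAt E' (TangentSpace I' : M' → Type _) (f x)).symmₗ ℝ (f x)
        (mvfderiv I (coordAlong I' f x V) x u)
      + cov (FiberBundle.extend E' (V x)) (f x) (mfderiv I I' f x u) := by
  rw [Bundle.Trivialization.coe_symmₗ _ (FiberBundle.mem_baseSet_trivializationAt' (f x))]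
  rfl

lemma symmₗ_coordAlong :
    (trivializationAt E' (TangentSpace I' : M' → Type _) (f x)).symmₗ ℝ (f x)
      (coordAlong I' f x V x) = V x := by
  have h := FiberBundle.mem_baseSet_trivializationAt' (F := E')
    (E := (TangentSpace I' : M' → Type _)) (f x)
  rw [Bundle.Trivialization.coe_symmₗ _ h]
  exact Bundle.Trivialization.symm_apply_apply_mk _ h (V x)

lemma mvfderiv_congr {F : Type*} [NormedAddCommGroup F] [NormedSpace ℝ F] {g k : M → F}
    (h : g =ᶠ[𝓝 x] k) (u : TangentSpace I x) : mvfderiv I g x u = mvfderiv I k x u := by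
  have := h.mfderiv_eq (I := I) (I' := 𝓘(ℝ, F))
  simp only [mvfderiv]
  exact congrArg (fun T : E →L[ℝ] F => T u) this

lemma covAlong_congr (h : ∀ᶠ y in 𝓝 x, V y = W y) (u : TangentSpace I x) :
    covAlong I I' cov f V x u = covAlong I I' cov f W x u := by
  have hc : coordAlong I' f x V =ᶠ[𝓝 x] coordAlong I' f x W := by
    filter_upwards [h] with y hy
    simp only [coordAlong, hy]
  rw [covAlong_eq, covAlong_eq, mvfderiv_congr hc, h.self_of_nhds]

lemma covAlong_add (hf : MDifferentiableAt I I' f x) (hV : MDifferentiableAlongAt I I' f V x)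
    (hW : MDifferentiableAlongAt I I' f W x) (u : TangentSpace I x) :
    covAlong I I' cov f (V + W) x u
      = covAlong I I' cov f V x u + covAlong I I' cov f W x u := by
  rw [mdifferentiableAlongAt_iff hf] at hV hW
  simp only [covAlong_eq, Pi.add_apply, cov_extend_add]
  rw [mvfderiv_congr (coordAlong_add_eventuallyEq hf.continuousAt), mvfderiv_add hV hW]
  simp only [add_apply, map_add]
  abel

lemma covAlong_smul {g : M → ℝ} (hf : MDifferentiableAt I I' f x)
    (hg : MDifferentiableAt I 𝓘(ℝ, ℝ) g x) (hV : MDifferentiableAlongAt I I' f V x)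
    (u : TangentSpace I x) :
    covAlong I I' cov f (fun y => g y • V y) x u
      = g x • covAlong I I' cov f V x u + mvfderiv I g x u • V x := by
  rw [mdifferentiableAlongAt_iff hf] at hV
  simp only [covAlong_eq, cov_extend_smul]
  rw [mvfderiv_congr (coordAlong_smul_eventuallyEq hf.continuousAt), mvfderiv_smul hg hV]
  simp only [add_apply, smul_apply,
    ContinuousLinearMap.smulRight_apply, map_add, map_smul, symmₗ_coordAlong]
  module

lemma covAlong_sum {ι : Type*} (s : Finset ι) {g : ι → M → ℝ}
    {Z : ι → Π x : M, TangentSpace I' (f x)} (hf : MDifferentiableAt I I' f x)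
    (hg : ∀ i, MDifferentiableAt I 𝓘(ℝ, ℝ) (g i) x)
    (hZ : ∀ i, MDifferentiableAlongAt I I' f (Z i) x) (u : TangentSpace I x) :
    MDifferentiableAlongAt I I' f (fun y => ∑ i ∈ s, g i y • Z i y) x ∧
      covAlong I I' cov f (fun y => ∑ i ∈ s, g i y • Z i y) x u
        = ∑ i ∈ s, (g i x • covAlong I I' cov f (Z i) x u + mvfderiv I (g i) x u • Z i x) := by
  classical
  induction s using Finset.induction_on with
  | empty =>
    simp only [Finset.sum_empty]
    have h0 : MDifferentiableAlongAt I I' f (fun _ => 0) x :=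
      MDifferentiableAlongAt.comp hf (mdifferentiableAt_zeroSection ℝ (TangentSpace I' : M' → Type _))
    refine ⟨h0, ?_⟩
    have := covAlong_smul cov (g := fun _ => (0 : ℝ)) hf mdifferentiableAt_const h0 u
    simpa [mvfderiv_const] using this
  | insert i s hi ih =>
    simp only [Finset.sum_insert hi]
    have h2 := (hZ i).smul hf (hg i)
    refine ⟨h2.add hf ih.1, ?_⟩
    rw [← ih.2, ← covAlong_smul cov hf (hg i) (hZ i)]
    exact covAlong_add cov hf h2 ih.1 u

lemma coordAlong_extend_eventuallyEq {y : M'} (v : TangentSpace I' y) :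
    coordAlong I' (fun z : M' => z) y (FiberBundle.extend E' v) =ᶠ[𝓝 y]
      fun _ => ((trivializationAt E' (TangentSpace I' : M' → Type _) y) ⟨y, v⟩).2 := by
  filter_upwards [eventually_mem_baseSet (I' := I') (f := fun z : M' => z) continuousAt_id]
    with z hz
  simp only [coordAlong, FiberBundle.extend]
  rw [Bundle.Trivialization.apply_mk_symm _ hz]

/-- A connection is the sum of the coordinate derivative in the trivialization around `y` and the
derivative of the coordinatewise constant extension. -/
lemma cov_eq {y : M'} {Z : Π z : M', TangentSpace I' z}
    (hZ : MDifferentiableAt I' I'.tangent (fun z => (⟨z, Z z⟩ : TangentBundle I' M')) y)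
    (w : TangentSpace I' y) :
    cov Z y w = (trivializationAt E' (TangentSpace I' : M' → Type _) y).symmₗ ℝ y
        (mvfderiv I' (coordAlong I' (fun z : M' => z) y Z) y w)
      + cov (FiberBundle.extend E' (Z y)) y w := by
  have hid : MDifferentiableAt I' I' (fun z : M' => z) y := mdifferentiableAt_id
  have hc := cov.isCovariantDerivativeOn (s := univ)
  have ht : TensorialAt I' E' (fun Z : Π z : M', TangentSpace I' z =>
      cov Z y w - (trivializationAt E' (TangentSpace I' : M' → Type _) y).symmₗ ℝ y
        (mvfderiv I' (coordAlong I' (fun z : M' => z) y Z) y w)) y := by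
    constructor
    · intro g Z hg hZ
      have hZ' := (mdifferentiableAlongAt_iff (f := fun z : M' => z) hid).1 hZ
      have h1 := mvfderiv_congr (I := I') (coordAlong_smul_eventuallyEq (I' := I') (V := Z) (g := g)
        (f := fun z : M' => z) (x := y) continuousAt_id) w
      have h2 : mvfderiv I' (coordAlong I' (fun z : M' => z) y (g • Z)) y w = _ := h1
      rw [h2, mvfderiv_smul hg hZ', hc.leibniz hZ hg]
      have h3 := symmₗ_coordAlong (I' := I') (f := fun z : M' => z) (x := y) (V := Z)
      simp only [add_apply, smul_apply,
        ContinuousLinearMap.smulRight_apply, map_add, map_smul]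
      erw [h3]
      module
    · intro Z Z' hZ hZ'
      have h1 := (mdifferentiableAlongAt_iff (f := fun z : M' => z) hid).1 hZ
      have h2 := (mdifferentiableAlongAt_iff (f := fun z : M' => z) hid).1 hZ'
      have h3 : mvfderiv I' (coordAlong I' (fun z : M' => z) y (Z + Z')) y w = _ :=
        mvfderiv_congr (I := I') (coordAlong_add_eventuallyEq (I' := I') (V := Z) (W := Z')
        (f := fun z : M' => z) (x := y) continuousAt_id) w
      rw [h3, mvfderiv_add h1 h2, hc.add hZ hZ']
      simp only [add_apply, map_add]
      abel
  have h := ht.pointwise hZ (mdifferentiableAt_extend_tangent (Z y))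
    (FiberBundle.extend_apply_self E' (Z y)).symm
  rw [mvfderiv_congr (coordAlong_extend_eventuallyEq (Z y)), mvfderiv_const] at h
  simp only [zero_apply, map_zero, sub_zero] at h
  rw [← h]
  abel

lemma covAlong_comp {Z : Π z : M', TangentSpace I' z} (hf : MDifferentiableAt I I' f x)
    (hZ : MDifferentiableAt I' I'.tangent (fun z => (⟨z, Z z⟩ : TangentBundle I' M')) (f x))
    (u : TangentSpace I x) :
    covAlong I I' cov f (fun y => Z (f y)) x u = cov Z (f x) (mfderiv I I' f x u) := by
  have hid : MDifferentiableAt I' I' (fun z : M' => z) (f x) := mdifferentiableAt_id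
  have hZ' := (mdifferentiableAlongAt_iff (f := fun z : M' => z) hid).1 hZ
  rw [cov_eq cov hZ, covAlong_eq]
  congr 2
  exact mfderiv_comp_apply x hZ' hf u

end ConnectionAlong

section Compatibility

variable {E : Type*} [NormedAddCommGroup E] [NormedSpace ℝ E] [FiniteDimensional ℝ E]
  {H : Type*} [TopologicalSpace H] {I : ModelWithCorners ℝ E H}
  {M : Type*} [TopologicalSpace M] [ChartedSpace H M] [IsManifold I ∞ M]
  {E' : Type*} [NormedAddCommGroup E'] [NormedSpace ℝ E'] [FiniteDimensional ℝ E']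
  {H' : Type*} [TopologicalSpace H'] {I' : ModelWithCorners ℝ E' H'}
  {M' : Type*} [TopologicalSpace M'] [ChartedSpace H' M'] [IsManifold I' ∞ M']
  {cov : CovariantDerivative I' E' (TangentSpace I' : M' → Type _)}
  {f : M → M'} {x : M} {V W : Π x : M, TangentSpace I' (f x)}

lemma MDifferentiableAlongAt.map {J : Π y : M', TangentSpace I' y →L[ℝ] TangentSpace I' y}
    (hJ : IsSmoothTensorField J) (hf : MDifferentiableAt I I' f x)
    (hV : MDifferentiableAlongAt I I' f V x) :
    MDifferentiableAlongAt I I' f (fun y => J (f y) (V y)) x := by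
  have h : MDifferentiableAt I (I'.prod 𝓘(ℝ, E' →L[ℝ] E'))
      (fun y => TotalSpace.mk' (E' →L[ℝ] E')
        (E := fun x : M' => TangentSpace I' x →L[ℝ] TangentSpace I' x) (f y) (J (f y))) x :=
    MDifferentiableAt.comp x ((hJ (f x)).mdifferentiableAt (by simp)) hf
  exact h.clm_bundle_apply hV

/-- A parallel tensor field commutes with the connection along a map. -/
lemma covAlong_map {J : Π y : M', TangentSpace I' y →L[ℝ] TangentSpace I' y}
    (hJ : IsSmoothTensorField J) (hpar : IsParallelTensorField cov J)
    (hf : MDifferentiableAt I I' f x) (hV : MDifferentiableAlongAt I I' f V x)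
    (u : TangentSpace I x) :
    covAlong I I' cov f (fun y => J (f y) (V y)) x u
      = J (f x) (covAlong I I' cov f V x u) := by
  refine along_induction hf (fun V => covAlong I I' cov f (fun y => J (f y) (V y)) x u
      = J (f x) (covAlong I I' cov f V x u)) ?_ ?_ ?_ ?_ hV
  · intro V W _ _ h hV
    rw [← covAlong_congr cov h, ← hV]
    exact (covAlong_congr cov (h.mono fun y hy => by simp only [hy]) u).symm
  · intro V W hV hW h1 h2
    rw [covAlong_add cov hf hV hW, map_add, ← h1, ← h2,
      ← covAlong_add cov hf (hV.map hJ hf) (hW.map hJ hf)]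
    congr 1
    funext y
    exact map_add (J (f y)) _ _
  · intro g V hg hV h
    rw [covAlong_smul cov hf hg hV, map_add, map_smul, map_smul, ← h,
      ← covAlong_smul cov hf hg (hV.map hJ hf)]
    simp only [map_smul]
  · intro Z hZ
    have hJZ := MDifferentiableAlongAt.map (I := I') (f := fun y : M' => y) (x := f x) hJ
      mdifferentiableAt_id hZ
    rw [covAlong_comp cov hf hZ, covAlong_comp (Z := fun y => J y (Z y)) cov hf hJZ]
    exact sub_eq_zero.1 (hpar (f x) _ Z hZ)

section Metric

variable [RiemannianBundle (fun x : M' => TangentSpace I' x)]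
  [IsContMDiffRiemannianBundle I' ∞ E' (fun x : M' => TangentSpace I' x)]

lemma MDifferentiableAlongAt.inner (hV : MDifferentiableAlongAt I I' f V x)
    (hW : MDifferentiableAlongAt I I' f W x) :
    MDifferentiableAt I 𝓘(ℝ, ℝ) (fun y => inner ℝ (V y) (W y)) x :=
  haveI : IsContMDiffRiemannianBundle I' 1 E' (fun x : M' => TangentSpace I' x) :=
    IsContMDiffRiemannianBundle.of_le (n := ∞) (by simp)
  MDifferentiableAt.inner_bundle hV hW

/-- The connection along a map induced by the Levi-Civita connection is metric. -/
lemma covAlong_metric (hcov : IsLeviCivita cov) (hf : MDifferentiableAt I I' f x)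
    (hV : MDifferentiableAlongAt I I' f V x) (hW : MDifferentiableAlongAt I I' f W x)
    (u : TangentSpace I x) :
    mvfderiv I (fun y => inner ℝ (V y) (W y)) x u
      = inner ℝ (covAlong I I' cov f V x u) (W x)
        + inner ℝ (V x) (covAlong I I' cov f W x u) := by
  have hred (W : Π x : M, TangentSpace I' (f x)) (hW : MDifferentiableAlongAt I I' f W x)
      (hcomp : ∀ Z : Π y : M', TangentSpace I' y,
        MDifferentiableAt I' I'.tangent (fun y => (⟨y, Z y⟩ : TangentBundle I' M')) (f x) →
        mvfderiv I (fun y => inner ℝ (Z (f y)) (W y)) x u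
          = inner ℝ (covAlong I I' cov f (fun y => Z (f y)) x u) (W x)
            + inner ℝ (Z (f x)) (covAlong I I' cov f W x u))
      (V : Π x : M, TangentSpace I' (f x)) (hV : MDifferentiableAlongAt I I' f V x) :
      mvfderiv I (fun y => inner ℝ (V y) (W y)) x u
        = inner ℝ (covAlong I I' cov f V x u) (W x)
          + inner ℝ (V x) (covAlong I I' cov f W x u) := by
    refine along_induction hf (fun V => mvfderiv I (fun y => inner ℝ (V y) (W y)) x u
        = inner ℝ (covAlong I I' cov f V x u) (W x)
          + inner ℝ (V x) (covAlong I I' cov f W x u)) ?_ ?_ ?_ hcomp hV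
    · intro V V' _ _ h hV
      rw [← covAlong_congr cov h, ← h.self_of_nhds, ← hV]
      exact (mvfderiv_congr (h.mono fun y hy => by simp only [hy]) u).symm
    · intro V V' hV hV' h1 h2
      rw [covAlong_add cov hf hV hV']
      simp only [Pi.add_apply, inner_add_left]
      rw [mvfderiv_fun_add (hV.inner hW) (hV'.inner hW), add_apply, h1, h2]
      ring
    · intro g V hg hV h
      rw [covAlong_smul cov hf hg hV]
      simp only [inner_add_left, real_inner_smul_left]
      rw [mvfderiv_fun_mul hg (hV.inner hW)]
      simp only [add_apply, smul_apply, h, smul_eq_mul]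
      ring
  refine hred W hW (fun Z hZ => ?_) V hV
  have hZf := MDifferentiableAlongAt.comp hf hZ
  have h1 := hred _ hZf (fun Z' hZ' => ?_) W hW
  · simp only [real_inner_comm] at h1 ⊢
    rw [h1]
    ring
  · rw [covAlong_comp cov hf hZ, covAlong_comp cov hf hZ', ← hcov.metric (f x) _ Z' Z hZ' hZ]
    exact mvfderiv_comp_apply x (MDifferentiableAlongAt.inner (I := I') (f := fun y : M' => y)
      (x := f x) hZ' hZ) hf u

end Metric

end Compatibility

section Torsion

variable {E : Type*} [NormedAddCommGroup E] [NormedSpace ℝ E] [FiniteDimensional ℝ E]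
  {H : Type*} [TopologicalSpace H] {I : ModelWithCorners ℝ E H} [I.Boundaryless]
  {M : Type*} [TopologicalSpace M] [ChartedSpace H M] [IsManifold I ∞ M]
  {E' : Type*} [NormedAddCommGroup E'] [NormedSpace ℝ E'] [FiniteDimensional ℝ E']
  {H' : Type*} [TopologicalSpace H'] {I' : ModelWithCorners ℝ E' H'} [I'.Boundaryless]
  {M' : Type*} [TopologicalSpace M'] [ChartedSpace H' M'] [IsManifold I' ∞ M']
  {cov : CovariantDerivative I' E' (TangentSpace I' : M' → Type _)}
  {f : M → M'} {x : M}

lemma trivializationAt_snd_eq_mvfderiv {y : M} (v : TangentSpace I y)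
    (hy : y ∈ (chartAt H x).source) :
    ((trivializationAt E (TangentSpace I : M → Type _) x) ⟨y, v⟩).2
      = mvfderiv I (extChartAt I x) y v := by
  have hy' : y ∈ (trivializationAt E (TangentSpace I : M → Type _) x).baseSet := hy
  have h1 := TangentBundle.continuousLinearMapAt_trivializationAt (I := I) hy
  refine Eq.trans ?_ (congrArg (fun T : TangentSpace I y →L[ℝ] E => T v) h1)
  simp only [Bundle.Trivialization.continuousLinearMapAt_apply]
  rw [Bundle.Trivialization.linearMapAt_apply, if_pos hy']

lemma mvfderiv_extChartAt_extend {y : M} (v : TangentSpace I x) (hy : y ∈ (chartAt H x).source) :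
    mvfderiv I (extChartAt I x) y (FiberBundle.extend E v y)
      = mvfderiv I (extChartAt I x) x v := by
  rw [← trivializationAt_snd_eq_mvfderiv _ hy,
    ← trivializationAt_snd_eq_mvfderiv _ (mem_chart_source H x)]
  simp only [FiberBundle.extend]
  rw [Bundle.Trivialization.apply_mk_symm]
  exact hy

lemma extend_eq_mfderivWithin_symm {y : M} (v : TangentSpace I x)
    (hy : y ∈ (chartAt H x).source) :
    FiberBundle.extend E v y
      = mfderivWithin 𝓘(ℝ, E) I (extChartAt I x).symm (range I) (extChartAt I x y)
          (mvfderiv I (extChartAt I x) x v) := by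
  have hy' : y ∈ (trivializationAt E (TangentSpace I : M → Type _) x).baseSet := hy
  have h := TangentBundle.symmL_trivializationAt (I := I) hy
  rw [← h, ← trivializationAt_snd_eq_mvfderiv v (mem_chart_source H x)]
  exact (Bundle.Trivialization.symmₗ_apply (R := ℝ) _ hy' _).symm

lemma lieBracketWithin_univ_eq_zero {V W : E → E} {a b z : E} (hV : V =ᶠ[𝓝 z] fun _ => a)
    (hW : W =ᶠ[𝓝 z] fun _ => b) : VectorField.lieBracketWithin ℝ V W univ z = 0 := by
  rw [VectorField.lieBracketWithin_univ, VectorField.lieBracket, hV.fderiv_eq, hW.fderiv_eq]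
  simp

/-- Coordinate vector fields of a chart commute. -/
lemma mlieBracket_extend (v w : TangentSpace I x) :
    VectorField.mlieBracket I (FiberBundle.extend E v) (FiberBundle.extend E w) x = 0 := by
  have hconst (v : TangentSpace I x) :
      VectorField.mpullbackWithin 𝓘(ℝ, E) I (extChartAt I x).symm (FiberBundle.extend E v) (range I)
        =ᶠ[𝓝 (extChartAt I x x)] fun _ => mvfderiv I (extChartAt I x) x v := by
    filter_upwards [extChartAt_target_mem_nhds (I := I) x] with z hz
    have hz' : (extChartAt I x).symm z ∈ (chartAt H x).source := by
      simpa using (extChartAt I x).map_target hz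
    rw [VectorField.mpullbackWithin_apply, extend_eq_mfderivWithin_symm v hz',
      (extChartAt I x).right_inv hz]
    exact (isInvertible_mfderivWithin_extChartAt_symm hz).inverse_apply_self _
  have hzero := lieBracketWithin_univ_eq_zero (hconst v) (hconst w)
  rw [← VectorField.mlieBracketWithin_univ, VectorField.mlieBracketWithin_apply]
  simp only [I.range_eq_univ, preimage_univ, inter_univ] at hzero ⊢
  rw [hzero]
  exact map_zero (mfderiv I 𝓘(ℝ, E) (extChartAt I x) x).inverse

lemma contDiffAt_writtenInExtChartAt (hf : ContMDiff I I' ∞ f) :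
    ContDiffAt ℝ 2 (writtenInExtChartAt I I' x f) (extChartAt I x x) := by
  have h := (contMDiffAt_iff.1 (hf x)).2
  rw [I.range_eq_univ, contDiffWithinAt_univ] at h
  exact h.of_le (by norm_cast)

lemma coordAlong_pushforward_extend (hf : ContMDiff I I' ∞ f) (v : TangentSpace I x) :
    coordAlong I' f x (pushforward I I' f (FiberBundle.extend E v)) =ᶠ[𝓝 x]
      fun y => fderiv ℝ (writtenInExtChartAt I I' x f) (extChartAt I x y)
        (mvfderiv I (extChartAt I x) x v) := by
  have hF := (continuousAt_extChartAt (I := I) x).eventually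
    ((contDiffAt_writtenInExtChartAt (x := x) hf).eventually (by simp))
  filter_upwards [(chartAt H x).open_source.mem_nhds (mem_chart_source H x),
    hf.continuous.continuousAt
      ((chartAt H' (f x)).open_source.mem_nhds (mem_chart_source H' (f x))), hF] with y hy hfy hFy
  have hfy' : f y ∈ (chartAt H' (f x)).source := hfy
  have heq : extChartAt I' (f x) ∘ f
      =ᶠ[𝓝 y] writtenInExtChartAt I I' x f ∘ extChartAt I x := by
    filter_upwards [(chartAt H x).open_source.mem_nhds hy] with z hz
    simp only [writtenInExtChartAt, Function.comp_apply]
    rw [(extChartAt I x).left_inv (by simpa using hz)]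
  have h1 := mfderiv_comp_apply y (mdifferentiableAt_extChartAt (I := I') hfy')
    ((hf y).mdifferentiableAt (by simp)) (FiberBundle.extend E v y)
  have h2 := mfderiv_comp_apply y (hFy.differentiableAt (by simp)).mdifferentiableAt
    (mdifferentiableAt_extChartAt (I := I) hy) (FiberBundle.extend E v y)
  have h3 := mvfderiv_congr (I := I) heq (FiberBundle.extend E v y)
  rw [coordAlong, trivializationAt_snd_eq_mvfderiv _ hfy', ← mvfderiv_extChartAt_extend v hy,
    ← mfderiv_eq_fderiv]
  exact h1.symm.trans (h3.trans h2)

lemma mvfderiv_coordAlong_pushforward_extend_comm (hf : ContMDiff I I' ∞ f)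
    (v w : TangentSpace I x) :
    mvfderiv I (coordAlong I' f x (pushforward I I' f (FiberBundle.extend E v))) x w
      = mvfderiv I (coordAlong I' f x (pushforward I I' f (FiberBundle.extend E w))) x v := by
  have hF := contDiffAt_writtenInExtChartAt (x := x) hf
  have hd : DifferentiableAt ℝ (fderiv ℝ (writtenInExtChartAt I I' x f)) (extChartAt I x x) :=
    (hF.fderiv_right (m := 1) (by norm_num)).differentiableAt (by simp)
  have hderiv (a : E) (u : TangentSpace I x) :
      mvfderiv I (fun y => fderiv ℝ (writtenInExtChartAt I I' x f) (extChartAt I x y) a) x u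
        = fderiv ℝ (fderiv ℝ (writtenInExtChartAt I I' x f)) (extChartAt I x x)
            (mvfderiv I (extChartAt I x) x u) a := by
    have hda : HasFDerivAt (fun z => fderiv ℝ (writtenInExtChartAt I I' x f) z a)
        ((ContinuousLinearMap.apply ℝ E' a).comp
          (fderiv ℝ (fderiv ℝ (writtenInExtChartAt I I' x f)) (extChartAt I x x)))
        (extChartAt I x x) :=
      (ContinuousLinearMap.apply ℝ E' a).hasFDerivAt.comp _ hd.hasFDerivAt
    have h := mfderiv_comp_apply x hda.differentiableAt.mdifferentiableAt
      (mdifferentiableAt_extChartAt (I := I) (mem_chart_source H x)) u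
    refine h.trans ?_
    rw [mfderiv_eq_fderiv, hda.fderiv]
    rfl
  rw [mvfderiv_congr (coordAlong_pushforward_extend hf v),
    mvfderiv_congr (coordAlong_pushforward_extend hf w), hderiv, hderiv]
  exact hF.isSymmSndFDerivAt (by simp) _ _

/-- The connection along `f` induced by a torsion free connection is symmetric on coordinate vector
fields. -/
lemma covAlong_pushforward_extend_comm (hcov : cov.torsion = 0)
    (hf : ContMDiff I I' ∞ f) (v w : TangentSpace I x) :
    covAlong I I' cov f (pushforward I I' f (FiberBundle.extend E v)) x w
      = covAlong I I' cov f (pushforward I I' f (FiberBundle.extend E w)) x v := by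
  rw [covAlong_eq, covAlong_eq, mvfderiv_coordAlong_pushforward_extend_comm hf]
  congr 1
  have h := cov.torsion_apply_eq_extend (mfderiv I I' f x w) (mfderiv I I' f x v)
  rw [hcov, mlieBracket_extend] at h
  simp only [FiberBundle.extend_apply_self, sub_zero] at h
  simp only [pushforward, FiberBundle.extend_apply_self]
  exact sub_eq_zero.1 h.symm

lemma cov_extend_comm {D : CovariantDerivative I E (TangentSpace I : M → Type _)}
    (hD : D.torsion = 0) (v w : TangentSpace I x) :
    D (FiberBundle.extend E v) x w = D (FiberBundle.extend E w) x v := by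
  have h := D.torsion_apply_eq_extend w v
  rw [hD, mlieBracket_extend] at h
  simp only [FiberBundle.extend_apply_self, sub_zero] at h
  exact sub_eq_zero.1 h.symm

end Torsion

section Submanifold

variable {E : Type*} [NormedAddCommGroup E] [NormedSpace ℝ E] [FiniteDimensional ℝ E]
  {H : Type*} [TopologicalSpace H] {I : ModelWithCorners ℝ E H} [I.Boundaryless]
  {M : Type*} [TopologicalSpace M] [ChartedSpace H M] [IsManifold I ∞ M]
  {E' : Type*} [NormedAddCommGroup E'] [NormedSpace ℝ E'] [FiniteDimensional ℝ E']
  {H' : Type*} [TopologicalSpace H'] {I' : ModelWithCorners ℝ E' H'} [I'.Boundaryless]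
  {M' : Type*} [TopologicalSpace M'] [ChartedSpace H' M'] [IsManifold I' ∞ M']
  {cov : CovariantDerivative I' E' (TangentSpace I' : M' → Type _)}
  {D : CovariantDerivative I E (TangentSpace I : M → Type _)}
  {f : M → M'} {x : M} {Y : Π x : M, TangentSpace I x}

lemma mdifferentiableAlongAt_pushforward (hf : ContMDiff I I' ∞ f)
    (hY : MDifferentiableAt I I.tangent (fun y => (⟨y, Y y⟩ : TangentBundle I M)) x) :
    MDifferentiableAlongAt I I' f (pushforward I I' f Y) x :=
  ((hf.contMDiff_tangentMap (m := 1) (by norm_cast) _).mdifferentiableAt (by simp)).comp x hY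

variable (cov D) in
/-- The difference between the connection along `f` and the connection of `M` is tensorial. -/
lemma tensorialAt_covAlong_pushforward_sub (hf : ContMDiff I I' ∞ f) (u : TangentSpace I x) :
    TensorialAt I E (fun Y : Π y : M, TangentSpace I y =>
      covAlong I I' cov f (pushforward I I' f Y) x u - mfderiv I I' f x (D Y x u)) x := by
  have hfx : MDifferentiableAt I I' f x := (hf x).mdifferentiableAt (by simp)
  have hc := D.isCovariantDerivativeOn (s := univ)
  constructor
  · intro g Y hg hY
    have h : pushforward I I' f (g • Y) = fun y => g y • pushforward I I' f Y y := by
      funext y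
      exact map_smul (mfderiv I I' f y) _ _
    rw [h, covAlong_smul cov hfx hg (mdifferentiableAlongAt_pushforward hf hY), hc.leibniz hY hg]
    simp only [add_apply, smul_apply, ContinuousLinearMap.smulRight_apply, map_add, map_smul,
      pushforward]
    module
  · intro Y Z hY hZ
    have h : pushforward I I' f (Y + Z) = pushforward I I' f Y + pushforward I I' f Z := by
      funext y
      exact map_add (mfderiv I I' f y) _ _
    rw [h, covAlong_add cov hfx (mdifferentiableAlongAt_pushforward hf hY)
      (mdifferentiableAlongAt_pushforward hf hZ), hc.add hY hZ]
    simp only [add_apply, map_add]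
    abel

variable [RiemannianBundle (fun x : M' => TangentSpace I' x)]

lemma mfderiv_mem_tangentImage (v : TangentSpace I x) :
    mfderiv I I' f x v ∈ tangentImage I I' f x := ⟨v, rfl⟩

lemma tangentialPart_add (v w : TangentSpace I' (f x)) :
    tangentialPart I I' f x (v + w) = tangentialPart I I' f x v + tangentialPart I I' f x w :=
  map_add (tangentImage I I' f x).starProjection v w

lemma normalPart_add (v w : TangentSpace I' (f x)) :
    normalPart I I' f x (v + w) = normalPart I I' f x v + normalPart I I' f x w :=
  map_add (tangentImage I I' f x)ᗮ.starProjection v w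

lemma tangentialPart_sum_smul {ι : Type*} (s : Finset ι) (c : ι → ℝ)
    (v : ι → TangentSpace I' (f x)) :
    tangentialPart I I' f x (∑ i ∈ s, c i • v i)
      = ∑ i ∈ s, c i • tangentialPart I I' f x (v i) := by
  simp only [tangentialPart, map_sum, map_smul]

lemma normalPart_sum_smul {ι : Type*} (s : Finset ι) (c : ι → ℝ)
    (v : ι → TangentSpace I' (f x)) :
    normalPart I I' f x (∑ i ∈ s, c i • v i) = ∑ i ∈ s, c i • normalPart I I' f x (v i) := by
  simp only [normalPart, map_sum, map_smul]

lemma tangentialPart_eq_zero {v : TangentSpace I' (f x)} (hv : v ∈ (tangentImage I I' f x)ᗮ) :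
    tangentialPart I I' f x v = 0 :=
  (Submodule.starProjection_apply_eq_zero_iff _).2 hv

lemma normalPart_eq_self {v : TangentSpace I' (f x)} (hv : v ∈ (tangentImage I I' f x)ᗮ) :
    normalPart I I' f x v = v :=
  Submodule.starProjection_eq_self_iff.2 hv

lemma tangentialPart_add_normalPart (v : TangentSpace I' (f x)) :
    tangentialPart I I' f x v + normalPart I I' f x v = v :=
  Submodule.starProjection_add_starProjection_orthogonal v

lemma inner_tangentialPart {v w : TangentSpace I' (f x)} (hw : w ∈ tangentImage I I' f x) :
    inner ℝ (tangentialPart I I' f x v) w = inner ℝ v w := by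
  conv_rhs => rw [← tangentialPart_add_normalPart (I := I) v, inner_add_left]
  have h : inner ℝ (normalPart I I' f x v) w = 0 :=
    Submodule.inner_left_of_mem_orthogonal hw (Submodule.starProjection_apply_mem _ v)
  rw [h, add_zero]

lemma inner_normalPart {v w : TangentSpace I' (f x)} (hw : w ∈ (tangentImage I I' f x)ᗮ) :
    inner ℝ (normalPart I I' f x v) w = inner ℝ v w := by
  conv_rhs => rw [← tangentialPart_add_normalPart (I := I) v, inner_add_left]
  have h : inner ℝ (tangentialPart I I' f x v) w = 0 :=
    Submodule.inner_right_of_mem_orthogonal (Submodule.starProjection_apply_mem _ v) hw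
  rw [h, zero_add]

variable [IsContMDiffRiemannianBundle I' ∞ E' (fun x : M' => TangentSpace I' x)]
  [RiemannianBundle (fun x : M => TangentSpace I x)]
  [IsContMDiffRiemannianBundle I ∞ E (fun x : M => TangentSpace I x)]

lemma inner_covAlong_pushforward_sub (hcov : IsLeviCivita cov) (hD : IsLeviCivita D)
    (hf : IsIsometricImmersion I I' f)
    (hY : MDifferentiableAt I I.tangent (fun y => (⟨y, Y y⟩ : TangentBundle I M)) x)
    (u z : TangentSpace I x) :
    inner ℝ (covAlong I I' cov f (pushforward I I' f Y) x u - mfderiv I I' f x (D Y x u))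
      (mfderiv I I' f x z) = 0 := by
  have hfx : MDifferentiableAt I I' f x := (hf.smooth x).mdifferentiableAt (by simp)
  let c (u v z : TangentSpace I x) : ℝ :=
    inner ℝ (covAlong I I' cov f (pushforward I I' f (FiberBundle.extend E v)) x u
      - mfderiv I I' f x (D (FiberBundle.extend E v) x u)) (mfderiv I I' f x z)
  have hsymm u v z : c u v z = c v u z := by
    simp only [c]
    rw [covAlong_pushforward_extend_comm hcov.torsion hf.smooth, cov_extend_comm hD.torsion]
  have hanti u v z : c u v z = - c u z v := by
    have hv := mdifferentiableAt_extend_tangent (I' := I) v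
    have hz := mdifferentiableAt_extend_tangent (I' := I) z
    have h1 := covAlong_metric hcov hfx (mdifferentiableAlongAt_pushforward hf.smooth hv)
      (mdifferentiableAlongAt_pushforward hf.smooth hz) u
    have h2 := hD.metric x u _ _ hv hz
    simp only [pushforward, hf.isometric, FiberBundle.extend_apply_self] at h1 h2
    rw [h2] at h1
    simp only [c, inner_sub_left, hf.isometric]
    rw [real_inner_comm (mfderiv I I' f x v), real_inner_comm v]
    linarith
  have hzero u v z : c u v z = 0 := by
    have : c u v z = - c u v z := by
      conv_lhs => rw [hsymm, hanti, hsymm, hanti, hsymm, hanti]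
      ring
    linarith
  have h := (tensorialAt_covAlong_pushforward_sub cov D hf.smooth u).pointwise hY
    (mdifferentiableAt_extend_tangent (Y x)) (FiberBundle.extend_apply_self E (Y x)).symm
  have h' := hzero u (Y x) z
  simp only [c] at h'
  rwa [← h] at h'

/-- The Gauss formula: the tangential part of the ambient derivative of a tangent field is its
intrinsic derivative. -/
lemma tangentialPart_covAlong_pushforward (hcov : IsLeviCivita cov) (hD : IsLeviCivita D)
    (hf : IsIsometricImmersion I I' f)
    (hY : MDifferentiableAt I I.tangent (fun y => (⟨y, Y y⟩ : TangentBundle I M)) x)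
    (u : TangentSpace I x) :
    tangentialPart I I' f x (covAlong I I' cov f (pushforward I I' f Y) x u)
      = mfderiv I I' f x (D Y x u) := by
  refine Submodule.eq_starProjection_of_mem_of_inner_eq_zero (mfderiv_mem_tangentImage _) ?_
  rintro _ ⟨z, rfl⟩
  exact inner_covAlong_pushforward_sub hcov hD hf hY u z

/-- The Weingarten formula: the shape operator is minus the tangential part of the ambient
derivative of a normal field. -/
lemma mfderiv_shapeOperator (hcov : IsLeviCivita cov) (hf : IsIsometricImmersion I I' f)
    {ξ : Π x : M, TangentSpace I' (f x)} (hξ : MDifferentiableAlongAt I I' f ξ x)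
    (hnormal : ∀ᶠ y in 𝓝 x, ξ y ∈ (tangentImage I I' f y)ᗮ) (u : TangentSpace I x) :
    mfderiv I I' f x (shapeOperator I I' cov f x (ξ x) u)
      = - tangentialPart I I' f x (covAlong I I' cov f ξ x u) := by
  have hfx : MDifferentiableAt I I' f x := (hf.smooth x).mdifferentiableAt (by simp)
  obtain ⟨a, ha⟩ : ∃ a, mfderiv I I' f x a
      = - tangentialPart I I' f x (covAlong I I' cov f ξ x u) :=
    (tangentImage I I' f x).neg_mem (Submodule.starProjection_apply_mem _ _)
  have hspec (Y : Π y : M, TangentSpace I y)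
      (hY : MDifferentiableAt I I.tangent (fun y => (⟨y, Y y⟩ : TangentBundle I M)) x) :
      inner ℝ a (Y x) = inner ℝ (secondFundamentalForm I I' cov f x u Y) (ξ x) := by
    have h := covAlong_metric hcov hfx (mdifferentiableAlongAt_pushforward hf.smooth hY) hξ u
    have h0 : (fun y => inner ℝ (pushforward I I' f Y y) (ξ y)) =ᶠ[𝓝 x] fun _ => (0 : ℝ) := by
      filter_upwards [hnormal] with y hy
      exact Submodule.inner_right_of_mem_orthogonal (mfderiv_mem_tangentImage _) hy
    rw [mvfderiv_congr h0, mvfderiv_const, zero_apply] at h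
    rw [← hf.isometric, ha, secondFundamentalForm, inner_normalPart hnormal.self_of_nhds,
      inner_neg_left, inner_tangentialPart (mfderiv_mem_tangentImage _), real_inner_comm]
    simp only [pushforward] at h ⊢
    linarith
  have hshape := Classical.epsilon_spec (p := fun a : TangentSpace I x =>
    ∀ Y : Π y : M, TangentSpace I y,
      MDifferentiableAt I I.tangent (fun y => (⟨y, Y y⟩ : TangentBundle I M)) x →
        inner ℝ a (Y x) = inner ℝ (secondFundamentalForm I I' cov f x u Y) (ξ x)) ⟨a, hspec⟩
  have : shapeOperator I I' cov f x (ξ x) u = a := by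
    refine ext_inner_right ℝ fun v => ?_
    have hv := mdifferentiableAt_extend_tangent (I' := I) v
    have h := (hshape _ hv).trans (hspec _ hv).symm
    rwa [FiberBundle.extend_apply_self] at h
  rw [this, ha]

lemma IsNormalFrameOn.sum_inner_smul {r : ℕ} {N : Fin r → Π x : M, TangentSpace I' (f x)}
    {U : Set M} (hN : IsNormalFrameOn I I' f N U) (hx : x ∈ U) {w : TangentSpace I' (f x)}
    (hw : w ∈ (tangentImage I I' f x)ᗮ) :
    ∑ α, (inner ℝ w (N α x) : ℝ) • N α x = w := by
  rw [← hN.span x hx] at hw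
  obtain ⟨c, rfl⟩ := (Submodule.mem_span_range_iff_exists_fun ℝ).1 hw
  refine Finset.sum_congr rfl fun α _ => ?_
  rw [(hN.orthonormal x hx).inner_left_fintype]
  rfl

end Submanifold

end MetallicGeometry

end

theorem mainTheorem8 {n r p q : ℕ}
    {M : Type*} [TopologicalSpace M] [ChartedSpace (EuclideanSpace ℝ (Fin n)) M]
    [IsManifold (𝓡 n) ∞ M]
    [RiemannianBundle (fun x : M => TangentSpace (𝓡 n) x)]
    [IsContMDiffRiemannianBundle (𝓡 n) ∞ (EuclideanSpace ℝ (Fin n))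
      (fun x : M => TangentSpace (𝓡 n) x)]
    {M' : Type*} [TopologicalSpace M'] [ChartedSpace (EuclideanSpace ℝ (Fin (n + r))) M']
    [IsManifold (𝓡 (n + r)) ∞ M']
    [RiemannianBundle (fun x : M' => TangentSpace (𝓡 (n + r)) x)]
    [IsContMDiffRiemannianBundle (𝓡 (n + r)) ∞ (EuclideanSpace ℝ (Fin (n + r)))
      (fun x : M' => TangentSpace (𝓡 (n + r)) x)]
    -- the locally metallic ambient manifold `(M', J, g)` and its Levi-Civita connection `D'`
    (J : Π y : M', TangentSpace (𝓡 (n + r)) y →L[ℝ] TangentSpace (𝓡 (n + r)) y)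
    (D' : CovariantDerivative (𝓡 (n + r)) (EuclideanSpace ℝ (Fin (n + r)))
      (TangentSpace (𝓡 (n + r)) : M' → Type _))
    (hJ : MetallicGeometry.IsLocallyMetallicRiemannian p q J D')
    -- the Levi-Civita connection `D` of `M`
    (D : CovariantDerivative (𝓡 n) (EuclideanSpace ℝ (Fin n))
      (TangentSpace (𝓡 n) : M → Type _))
    (hD : MetallicGeometry.IsLeviCivita D)
    -- the anti-invariant isometric immersion
    (f : M → M') (hf : MetallicGeometry.IsIsometricImmersion (𝓡 n) (𝓡 (n + r)) f)
    (hanti : MetallicGeometry.IsAntiInvariant (𝓡 n) (𝓡 (n + r)) f J)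
    -- a local orthonormal frame of the normal bundle
    (U : Set M) (hU : IsOpen U)
    (N : Fin r → Π x : M, TangentSpace (𝓡 (n + r)) (f x))
    (hN : MetallicGeometry.IsNormalFrameOn (𝓡 n) (𝓡 (n + r)) f N U)
    -- vector fields on `M`
    (X Y : Π x : M, TangentSpace (𝓡 n) x)
    (hX : ContMDiff (𝓡 n) (𝓡 n).tangent ∞ (fun x => (⟨x, X x⟩ : TangentBundle (𝓡 n) M)))
    (hY : ContMDiff (𝓡 n) (𝓡 n).tangent ∞ (fun x => (⟨x, Y x⟩ : TangentBundle (𝓡 n) M)))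
    (x : M) (hx : x ∈ U) :
    (∑ α, inner ℝ (MetallicGeometry.secondFundamentalForm (𝓡 n) (𝓡 (n + r)) D' f x (X x) Y) (N α x) •
          MetallicGeometry.tangentialPart (𝓡 n) (𝓡 (n + r)) f x (J (f x) (N α x))
      = -∑ α, inner ℝ (J (f x) (MetallicGeometry.pushforward (𝓡 n) (𝓡 (n + r)) f Y x)) (N α x) •
          mfderiv (𝓡 n) (𝓡 (n + r)) f x
            (MetallicGeometry.shapeOperator (𝓡 n) (𝓡 (n + r)) D' f x (N α x) (X x))) ∧
    (∑ α, inner ℝ (MetallicGeometry.secondFundamentalForm (𝓡 n) (𝓡 (n + r)) D' f x (X x) Y) (N α x) •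
          MetallicGeometry.normalPart (𝓡 n) (𝓡 (n + r)) f x (J (f x) (N α x))
      = ∑ α, inner ℝ (J (f x) (MetallicGeometry.pushforward (𝓡 n) (𝓡 (n + r)) f Y x)) (N α x) •
          MetallicGeometry.normalConnection (𝓡 n) (𝓡 (n + r)) D' f (N α) x (X x)
        + ∑ α, mvfderiv (𝓡 n) (fun y : M =>
            inner ℝ (J (f y) (MetallicGeometry.pushforward (𝓡 n) (𝓡 (n + r)) f Y y)) (N α y))
              x (X x) • N α x
        - J (f x) (mfderiv (𝓡 n) (𝓡 (n + r)) f x (D Y x (X x)))) := by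
  have hfx : MDifferentiableAt (𝓡 n) (𝓡 (n + r)) f x := (hf.smooth x).mdifferentiableAt (by simp)
  have hYx := (hY x).mdifferentiableAt (by simp)
  have hpush := MetallicGeometry.mdifferentiableAlongAt_pushforward hf.smooth hYx
  have hUx : U ∈ 𝓝 x := hU.mem_nhds hx
  have hNx α : MetallicGeometry.MDifferentiableAlongAt (𝓡 n) (𝓡 (n + r)) f (N α) x :=
    ((hN.smooth α).contMDiffAt hUx).mdifferentiableAt (by simp)
  have hnormal α y (hy : y ∈ U) :
      N α y ∈ (MetallicGeometry.tangentImage (𝓡 n) (𝓡 (n + r)) f y)ᗮ := by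
    rw [← hN.span y hy]
    exact Submodule.subset_span ⟨α, rfl⟩
  have hJnormal (y : M) (v : TangentSpace (𝓡 n) y) :
      J (f y) (mfderiv (𝓡 n) (𝓡 (n + r)) f y v)
        ∈ (MetallicGeometry.tangentImage (𝓡 n) (𝓡 (n + r)) f y)ᗮ :=
    hanti y ⟨_, MetallicGeometry.mfderiv_mem_tangentImage v, rfl⟩
  have hsmooth := hJ.metallic.smooth
  have hJpush := hpush.map hsmooth hfx
  -- expand `J f_* Y` in the normal frame and differentiate
  have hcongr : ∀ᶠ y in 𝓝 x,
      J (f y) (MetallicGeometry.pushforward (𝓡 n) (𝓡 (n + r)) f Y y)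
        = ∑ α, (inner ℝ (J (f y) (MetallicGeometry.pushforward (𝓡 n) (𝓡 (n + r)) f Y y))
            (N α y) : ℝ) • N α y := by
    filter_upwards [hUx] with y hy
    exact (hN.sum_inner_smul hy (hJnormal y (Y y))).symm
  have hder := MetallicGeometry.covAlong_map hsmooth hJ.parallel hfx hpush (X x)
  rw [MetallicGeometry.covAlong_congr D' hcongr,
    (MetallicGeometry.covAlong_sum D' Finset.univ hfx (fun α => hJpush.inner (hNx α)) hNx (X x)).2,
    ← MetallicGeometry.tangentialPart_add_normalPart (I := 𝓡 n)
      (MetallicGeometry.covAlong (𝓡 n) (𝓡 (n + r)) D' f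
        (MetallicGeometry.pushforward (𝓡 n) (𝓡 (n + r)) f Y) x (X x)),
    MetallicGeometry.tangentialPart_covAlong_pushforward hJ.leviCivita hD hf hYx, map_add,
    Finset.sum_add_distrib] at hder
  have hh : MetallicGeometry.secondFundamentalForm (𝓡 n) (𝓡 (n + r)) D' f x (X x) Y
      ∈ (MetallicGeometry.tangentImage (𝓡 n) (𝓡 (n + r)) f x)ᗮ :=
    Submodule.starProjection_apply_mem _ _
  have hJh : J (f x) (MetallicGeometry.normalPart (𝓡 n) (𝓡 (n + r)) f x
      (MetallicGeometry.covAlong (𝓡 n) (𝓡 (n + r)) D' f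
        (MetallicGeometry.pushforward (𝓡 n) (𝓡 (n + r)) f Y) x (X x)))
      = ∑ α, (inner ℝ (MetallicGeometry.secondFundamentalForm (𝓡 n) (𝓡 (n + r)) D' f x (X x) Y)
          (N α x) : ℝ) • J (f x) (N α x) := by
    have h := congrArg (J (f x)) (hN.sum_inner_smul hx hh)
    simp only [map_sum, map_smul] at h
    exact h.symm
  rw [hJh] at hder
  have hT := congrArg (MetallicGeometry.tangentialPart (𝓡 n) (𝓡 (n + r)) f x) hder
  have hP := congrArg (MetallicGeometry.normalPart (𝓡 n) (𝓡 (n + r)) f x) hder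
  rw [MetallicGeometry.tangentialPart_add, MetallicGeometry.tangentialPart_add,
    MetallicGeometry.tangentialPart_eq_zero (hJnormal x _)] at hT
  rw [MetallicGeometry.normalPart_add, MetallicGeometry.normalPart_add,
    MetallicGeometry.normalPart_eq_self (hJnormal x _)] at hP
  simp only [MetallicGeometry.tangentialPart_sum_smul, MetallicGeometry.normalPart_sum_smul,
    MetallicGeometry.tangentialPart_eq_zero (hnormal _ x hx),
    MetallicGeometry.normalPart_eq_self (hnormal _ x hx), smul_zero, Finset.sum_const_zero,
    add_zero, zero_add] at hT hP
  constructor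
  · rw [← hT, ← Finset.sum_neg_distrib]
    refine Finset.sum_congr rfl fun α _ => ?_
    rw [MetallicGeometry.mfderiv_shapeOperator hJ.leviCivita hf (hNx α)
      (Filter.eventually_of_mem hUx (hnormal α)), smul_neg, neg_neg]
  · exact eq_sub_of_add_eq' hP.symm
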